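/- **Setting.** A (player-1) MDP $G=((S,E),(S_1,S_P),\delta)$ consists of a finite set $S$ of states partitioned into player-1 states $S_1$ and probabilistic states $S_P$, an edge relation $E\subseteq S\times S$ such that every state has at least one outgoing edge, and a map $\delta:S_P\to\mathcal D(S)$ into the probability distributions on $S$ such that, for $s\in S_P$ and $t\in S$, $(s,t)\in E$ iff $\delta(s)(t)>0$. Write $E(s)=\{t : (s,t)\in E\}$. $G$ is bipartite if $E\subseteq (S_1\times S_P)\cup(S_P\times S_1)$. A strategy is a map $\sigma:S^*\cdot S_1\to\mathcal D(S)$ (history-dependent and randomized) with $\sigma(\vec w\cdot s)(t)>0\Rightarrow (s,t)\in E$. A strategy $\sigma$ and a state $s$ determine the law $\mathrm{Pr}_s^\sigma$, with expectation $\mathbb E_s^\sigma$, of the random play $\omega=\langle s_0,s_1,\dots\rangle$ with $s_0=s$. For $\rho:S\to\mathbb R$ put $\liminf(\rho)(\omega)=\liminf_{i}\rho(s_i)$ and $\max(\rho)(\omega)=\max_{i}\rho(s_i)$. For a measurable $f$ let $\mathrm{Val}^G(f)(s)=\sup_\sigma\mathbb E_s^\sigma[f]$. For $C\subseteq S$ let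 $\mathrm{coBuchi}(C)$ be the event that every state visited infinitely often lies in $C$, and let $W^G(\mathrm{coBuchi}(C))=\{s : \sup_\sigma \mathrm{Pr}^\sigma_s(\mathrm{coBuchi}(C))=1\}$. For $U\subseteq S$ let $\mathrm{Attr}_P(U,G)=\bigcup_{i\ge0}T_i$, where $T_0=U$ and $T_{i+1}=T_i\cup\{s\in S_P : E(s)\cap T_i\ne\emptyset\}\cup\{s\in S_1 : E(s)\subseteq T_i\}$. **Algorithm MDPLimInf.** Let $r:S\to\mathbb R$ be a reward function with $r(s)>0$ for all $s\in S$, and let $r(S)=\{v_0>v_1>\dots>v_k\}$. Start with $G_0=G$, $S^0=S$, $S_*=\emptyset$. For $i=0,\dots,k$: let $U_i=W^{G_i}\big(\mathrm{coBuchi}(\{s\in S^i : r(s)\ge v_i\})\big)$; set $f_*(u)=v_i$ for all $u\in U_i\cap S_1$ and add $U_i\cap S_1$ to $S_*$; let $B_i=\mathrm{Attr}_P(U_i,G_i)$; let $S^{i+1}=S^i\setminus B_i$ and let $G_{i+1}$ be the restriction of $G_i$ to $S^{i+1}$ (which is again an MDP). The output is $S_*\subseteq S_1$ and $f_*:S_*\to\mathbb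 R$. **Liminf conversion.** $\overline G$ has the state space $\overline S=S\cup\widehat S_*$, where $\widehat S_*=\{\widehat s : s\in S_*\}$ is a disjoint copy of $S_*$; the edges $\overline E=E\cup\{(s,\widehat s) : s\in S_*\}\cup\{(\widehat s,\widehat s) : s\in S_*\}$; the player-1 states $\overline S_1=S_1\cup\widehat S_*$; the probabilistic states $S_P$; and $\overline\delta=\delta$. The reward function $\overline r$ is given by $\overline r(s)=0$ for $s\in S$ and $\overline r(\widehat s)=f_*(s)$ for $s\in S_*$. **Lemma.** Let $G$ be a bipartite MDP with a reward function $r:S\to\mathbb R$ such that $r(s)>0$ for all $s\in S$, and let $\overline G$ and $\overline r$ be obtained from $G$ and $r$ by the liminf conversion. Then for every state $s\in S$, $$\mathrm{Val}^G(\liminf(r))(s)=\mathrm{Val}^{\overline G}(\max(\overline r))(s).$$ -/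

import Mathlib

open Filter MeasureTheory ProbabilityTheory

/-- A (player-1) Markov decision process with state space `S`: a directed graph `Edge` on `S` in
which every state has a successor, the set `P1` of player-1 states, whose complement is the set of
probabilistic states, and a probabilistic transition function `δ` on the probabilistic states whose
support is exactly the set of successors. -/
structure MDP (S : Type*) where
  /-- The edge relation. -/
  Edge : S → S → Prop
  /-- The player-1 states; all other states are probabilistic. -/
  P1 : Set S
  /-- The probabilistic transition function. -/
  δ : ↥P1ᶜ → PMF S
  edge_iff : ∀ (s : ↥P1ᶜ) (t : S), Edge s t ↔ 0 < δ s t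
  exists_edge : ∀ s, ∃ t, Edge s t

namespace MDP

variable {S : Type*}

/-- Every edge joins a player-1 state and a probabilistic state. -/
def IsBipartite (G : MDP S) : Prop :=
  ∀ s t, G.Edge s t → (s ∈ G.P1 ∧ t ∉ G.P1) ∨ (s ∉ G.P1 ∧ t ∈ G.P1)

/-! ### Strategies and the random play -/

/-- A strategy: `next w s` is the distribution of the next state when the history is the word `w`
followed by the player-1 state `s`. It prescribes only available moves. -/
structure Strategy (G : MDP S) where
  next : List S → ↥G.P1 → PMF S
  edge_of_pos : ∀ (w : List S) (s : ↥G.P1) (t : S), 0 < next w s t → G.Edge s t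

open Classical in
/-- Distribution of the next state after the history `w` followed by `s`. -/
noncomputable def Strategy.step {G : MDP S} (σ : G.Strategy) (w : List S) (s : S) : PMF S :=
  if h : s ∈ G.P1 then σ.next w ⟨s, h⟩ else G.δ ⟨s, h⟩

/-- The transition kernel at time `n`, from histories `x 0, …, x n` to the next state. -/
noncomputable def Strategy.kernel {G : MDP S} [Finite S] [MeasurableSpace S]
    [DiscreteMeasurableSpace S] (σ : G.Strategy) (n : ℕ) :
    Kernel (∀ _ : Finset.Iic n, S) S where
  toFun x := (σ.step (List.ofFn fun i : Fin n => x ⟨i, Finset.mem_Iic.2 i.2.le⟩)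
    (x ⟨n, Finset.mem_Iic.2 le_rfl⟩)).toMeasure
  measurable' := Measurable.of_discrete

instance {G : MDP S} [Finite S] [MeasurableSpace S] [DiscreteMeasurableSpace S]
    (σ : G.Strategy) (n : ℕ) : IsMarkovKernel (σ.kernel n) :=
  ⟨fun _ => PMF.toMeasure.isProbabilityMeasure _⟩

/-- The law of the random play from `s` under `σ` (Ionescu-Tulcea), on infinite sequences of
states. -/
noncomputable def Strategy.playMeasure {G : MDP S} [Finite S] [MeasurableSpace S]
    [DiscreteMeasurableSpace S] (σ : G.Strategy) (s : S) : Measure (ℕ → S) :=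
  Kernel.traj (X := fun _ => S) σ.kernel 0 (fun _ => s)

/-- Probability of the event `A` from `s` under `σ`; the finite set of states carries the discrete
σ-algebra and the set of infinite sequences the product σ-algebra. -/
noncomputable def Strategy.prob {G : MDP S} [Finite S] (σ : G.Strategy) (s : S)
    (A : Set (ℕ → S)) : ℝ :=
  letI : MeasurableSpace S := ⊤
  (σ.playMeasure s).real A

/-- Expectation of `f` from `s` under `σ`. -/
noncomputable def Strategy.expect {G : MDP S} [Finite S] (σ : G.Strategy) (s : S)
    (f : (ℕ → S) → ℝ) : ℝ :=
  letI : MeasurableSpace S := ⊤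
  ∫ ω, f ω ∂(σ.playMeasure s)

/-! ### Objectives and values -/

/-- The liminf objective. -/
noncomputable def liminfObj (r : S → ℝ) (ω : ℕ → S) : ℝ := liminf (fun i => r (ω i)) atTop

/-- The max objective (on a finite state space the supremum is a maximum). -/
noncomputable def maxObj (r : S → ℝ) (ω : ℕ → S) : ℝ := ⨆ i, r (ω i)

/-- The set of states that occur infinitely often. -/
def infStates (ω : ℕ → S) : Set S := {s | ∃ᶠ k in atTop, ω k = s}

/-- The coBüchi objective: only states of `C` occur infinitely often. -/
def coBuchi (C : Set S) : Set (ℕ → S) := {ω | infStates ω ⊆ C}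

/-- The value of a quantitative objective. -/
noncomputable def value (G : MDP S) [Finite S] (f : (ℕ → S) → ℝ) (s : S) : ℝ :=
  ⨆ σ : G.Strategy, σ.expect s f

/-- The value of a qualitative objective. -/
noncomputable def qualValue (G : MDP S) [Finite S] (Φ : Set (ℕ → S)) (s : S) : ℝ :=
  ⨆ σ : G.Strategy, σ.prob s Φ

/-- The states of value `1` (almost-sure winning states) for a qualitative objective. -/
def winOne (G : MDP S) [Finite S] (Φ : Set (ℕ → S)) : Set S := {s | G.qualValue Φ s = 1}

/-! ### Sub-MDPs and attractors -/

/-- The sets of states to which `G` can be restricted: successors of probabilistic states stay in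
the set, and player-1 states keep at least one successor. -/
def IsSub (G : MDP S) (X : Set S) : Prop :=
  (∀ s ∈ X, s ∉ G.P1 → ∀ t, G.Edge s t → t ∈ X) ∧ (∀ s ∈ X, s ∈ G.P1 → ∃ t ∈ X, G.Edge s t)

/-- The restriction of `G` to the state space `X`. -/
noncomputable def restrict (G : MDP S) (X : Set S) (hX : G.IsSub X) : MDP ↥X where
  Edge s t := G.Edge s t
  P1 := {s | (s : S) ∈ G.P1}
  δ s := ⟨fun t => G.δ ⟨s.1.1, s.2⟩ t, by
    refine (hasSum_subtype_iff_of_support_subset (s := X) (f := G.δ ⟨s.1.1, s.2⟩) ?_).2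
      (G.δ ⟨s.1.1, s.2⟩).2
    intro t ht
    exact hX.1 _ s.1.2 s.2 t ((G.edge_iff ⟨s.1.1, s.2⟩ t).2 (pos_iff_ne_zero.2 ht))⟩
  edge_iff s t := G.edge_iff ⟨s.1.1, s.2⟩ t
  exists_edge s := by
    by_cases h : (s : S) ∈ G.P1
    · obtain ⟨t, ht, e⟩ := hX.2 s s.2 h
      exact ⟨⟨t, ht⟩, e⟩
    · obtain ⟨t, e⟩ := G.exists_edge s
      exact ⟨⟨t, hX.1 s s.2 h t e⟩, e⟩

/-- The stages `T_0 ⊆ T_1 ⊆ …` of the attractor of the probabilistic player. -/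
def attrStage (G : MDP S) (U : Set S) : ℕ → Set S
  | 0 => U
  | i + 1 => G.attrStage U i ∪ {s | s ∉ G.P1 ∧ ∃ t, G.Edge s t ∧ t ∈ G.attrStage U i} ∪
      {s | s ∈ G.P1 ∧ ∀ t, G.Edge s t → t ∈ G.attrStage U i}

/-- The attractor of the probabilistic player. -/
def attr (G : MDP S) (U : Set S) : Set S := ⋃ i, G.attrStage U i

lemma attrStage_mono (G : MDP S) (U : Set S) : Monotone (G.attrStage U) :=
  monotone_nat_of_le_succ fun _ _ hs => Or.inl (Or.inl hs)

lemma isSub_univ (G : MDP S) : G.IsSub Set.univ :=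
  ⟨fun _ _ _ _ _ => trivial, fun s _ _ => (G.exists_edge s).imp fun _ h => ⟨trivial, h⟩⟩

lemma isSub_compl_attr (G : MDP S) [Finite S] (U : Set S) : G.IsSub (G.attr U)ᶜ := by
  constructor
  · intro s hs h1 t e ht
    obtain ⟨i, hi⟩ := Set.mem_iUnion.1 ht
    exact hs (Set.mem_iUnion.2 ⟨i + 1, Or.inl (Or.inr ⟨h1, t, e, hi⟩)⟩)
  · intro s hs h1
    by_contra! hc
    have key : ∀ t, ∃ i, G.Edge s t → t ∈ G.attrStage U i := by
      intro t
      by_cases e : G.Edge s t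
      · have ht : t ∈ G.attr U := by
          by_contra h
          exact hc t h e
        obtain ⟨i, hi⟩ := Set.mem_iUnion.1 ht
        exact ⟨i, fun _ => hi⟩
      · exact ⟨0, fun h => absurd h e⟩
    choose n hn using key
    obtain ⟨N, hN⟩ := (Set.finite_range n).bddAbove
    exact hs (Set.mem_iUnion.2 ⟨N + 1, Or.inr ⟨h1, fun t e =>
      G.attrStage_mono U (hN ⟨t, rfl⟩) (hn t e)⟩⟩)

lemma IsSub.image {G : MDP S} {X : Set S} (hX : G.IsSub X) {Y : Set ↥X}
    (hY : (G.restrict X hX).IsSub Y) : G.IsSub (Subtype.val '' Y) := by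
  constructor
  · rintro _ ⟨s, hs, rfl⟩ h1 t e
    exact ⟨⟨t, hX.1 s s.2 h1 t e⟩, hY.1 s hs h1 _ e, rfl⟩
  · rintro _ ⟨s, hs, rfl⟩ h1
    obtain ⟨t, ht, e⟩ := hY.2 s hs h1
    exact ⟨t, ⟨t, ht, rfl⟩, e⟩

/-! ### The algorithm MDPLimInf -/

/-- The variables of the algorithm: the current state space (with the fact that `G` restricts to
it), the set `Sstar`, and the function `fstar`, which is meaningful on `Sstar` only. -/
structure LimInfState (G : MDP S) where
  live : Set S
  isSub : G.IsSub live
  Sstar : Set S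
  fstar : S → ℝ

/-- The current MDP. -/
noncomputable def LimInfState.cur {G : MDP S} (st : G.LimInfState) : MDP ↥st.live :=
  G.restrict st.live st.isSub

/-- The value-one set, in the current MDP, of the coBüchi objective given by the current states of
reward at least `v`. -/
def LimInfState.winSet {G : MDP S} [Finite S] (st : G.LimInfState) (r : S → ℝ) (v : ℝ) :
    Set ↥st.live :=
  st.cur.winOne (coBuchi {s | v ≤ r s})

open Classical in
/-- One iteration, for the reward `v`: the player-1 states of the value-one set are added to
`Sstar` and get `fstar = v`; then the attractor of the value-one set in the current MDP is
removed. -/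
noncomputable def limInfStep (G : MDP S) [Finite S] (r : S → ℝ) (st : G.LimInfState) (v : ℝ) :
    G.LimInfState where
  live := Subtype.val '' (st.cur.attr (st.winSet r v))ᶜ
  isSub := st.isSub.image (st.cur.isSub_compl_attr _)
  Sstar := st.Sstar ∪ (Subtype.val '' st.winSet r v ∩ G.P1)
  fstar s := if s ∈ Subtype.val '' st.winSet r v ∩ G.P1 then v else st.fstar s

/-- The distinct rewards `v_0 > v_1 > ⋯ > v_k`. -/
noncomputable def rewardList [Finite S] (r : S → ℝ) : List ℝ :=
  (Set.finite_range r).toFinset.sort (· ≥ ·)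

/-- The final state of the algorithm. -/
noncomputable def mdpLimInf (G : MDP S) [Finite S] (r : S → ℝ) : G.LimInfState :=
  (rewardList r).foldl (G.limInfStep r)
    { live := Set.univ, isSub := G.isSub_univ, Sstar := ∅, fstar := fun _ => 0 }

/-! ### The liminf conversion -/

/-- The edges of `G` with a copy added for each state in `A`: every state in `A` gets an edge to
its copy, and every copy gets a self-loop. -/
inductive CopyEdge (G : MDP S) (A : Set S) : S ⊕ ↥A → S ⊕ ↥A → Prop
  | old {s t : S} : G.Edge s t → CopyEdge G A (Sum.inl s) (Sum.inl t)
  | toCopy (s : ↥A) : CopyEdge G A (Sum.inl s) (Sum.inr s)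
  | loop (s : ↥A) : CopyEdge G A (Sum.inr s) (Sum.inr s)

/-- The MDP `G` with an absorbing copy added for each state of a set `A` of player-1 states; the
copies are player-1 states. -/
noncomputable def addCopies (G : MDP S) (A : Set S) (hA : A ⊆ G.P1) : MDP (S ⊕ ↥A) where
  Edge := G.CopyEdge A
  P1 := Sum.inl '' G.P1 ∪ Set.range Sum.inr
  δ
    | ⟨Sum.inl s, hs⟩ => (G.δ ⟨s, fun h => hs (Or.inl ⟨s, h, rfl⟩)⟩).map Sum.inl
    | ⟨Sum.inr a, hs⟩ => (hs (Or.inr ⟨a, rfl⟩)).elim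
  edge_iff := by
    rintro ⟨s | a, hs⟩ t
    · have h1 : s ∉ G.P1 := fun h => hs (Or.inl ⟨s, h, rfl⟩)
      rw [PMF.apply_pos_iff, PMF.support_map]
      constructor
      · intro e
        cases e with
        | old e => exact ⟨_, (PMF.apply_pos_iff _ _).1 ((G.edge_iff ⟨s, h1⟩ _).1 e), rfl⟩
        | toCopy a => exact absurd (hA a.2) h1
      · rintro ⟨u, hu, rfl⟩
        exact .old ((G.edge_iff ⟨s, h1⟩ u).2 ((PMF.apply_pos_iff _ _).2 hu))
    · exact (hs (Or.inr ⟨a, rfl⟩)).elim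
  exists_edge := by
    rintro (s | a)
    · obtain ⟨t, e⟩ := G.exists_edge s
      exact ⟨_, .old e⟩
    · exact ⟨_, .loop a⟩

lemma mdpLimInf_Sstar_subset (G : MDP S) [Finite S] (r : S → ℝ) :
    (G.mdpLimInf r).Sstar ⊆ G.P1 := by
  have key : ∀ (l : List ℝ) (st : G.LimInfState), st.Sstar ⊆ G.P1 →
      (l.foldl (G.limInfStep r) st).Sstar ⊆ G.P1 := by
    intro l
    induction l with
    | nil => exact fun _ h => h
    | cons v l ih => exact fun st h => ih _ (Set.union_subset h Set.inter_subset_right)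
  exact key _ _ (Set.empty_subset _)

/-- The MDP obtained from `G` and `r` by the liminf conversion. -/
noncomputable def limInfConversion (G : MDP S) [Finite S] (r : S → ℝ) :
    MDP (S ⊕ ↥(G.mdpLimInf r).Sstar) :=
  G.addCopies (G.mdpLimInf r).Sstar (G.mdpLimInf_Sstar_subset r)

/-- The reward function obtained from `G` and `r` by the liminf conversion. -/
noncomputable def limInfReward (G : MDP S) [Finite S] (r : S → ℝ) :
    S ⊕ ↥(G.mdpLimInf r).Sstar → ℝ
  | Sum.inl _ => 0
  | Sum.inr a => (G.mdpLimInf r).fstar a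

end MDP

namespace MDP

variable {S : Type*}

/-! Each inequality takes a function `W` that is excessive for the MDP on its left side. Along any
play `W (ω n)` is then a bounded supermartingale, so it converges almost surely, and a payoff that
is at most `W (ω n)` infinitely often has expectation at most `W s` (`Excessive.integral_le`).
Values of objectives that never drop when a state is prepended are excessive, by gluing near-optimal
strategies (`excessive_value`).

For `≤`, `W` is the max-value of the conversion, read on `S`. Almost surely the recurrent states
form a set `C` to which `G` restricts, and the liminf payoff is the least reward in `C`. The
algorithm must have put some `a ∈ C` in `Sstar` with `fstar a` at least that reward
(`exists_mem_Sstar`). The play returns to `a` infinitely often, and there `W a ≥ fstar a`, because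
one may move to the copy of `a`.

For `≥`, `W` is the liminf-value on `S` and `fstar` on the copies. It is excessive because `fstar a`
is at most the liminf-value at `a` (`fstar_pos_and_le_value`), and a play that has entered a copy
stays there. -/

/-- The mean of a real function under a probability mass function. -/
noncomputable def mean (p : PMF S) (W : S → ℝ) : ℝ := ∑' t, (p t).toReal * W t

/-- A function on the states is excessive if no move increases its expected value. -/
def Excessive (G : MDP S) (W : S → ℝ) : Prop :=
  (∀ s ∈ G.P1, ∀ t, G.Edge s t → W t ≤ W s) ∧ ∀ s (h : s ∉ G.P1), mean (G.δ ⟨s, h⟩) W ≤ W s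

lemma sum_toReal_pmf [Fintype S] (p : PMF S) : ∑ t, (p t).toReal = 1 := by
  rw [← ENNReal.toReal_sum fun t _ => p.apply_ne_top t, ← tsum_fintype (L := .unconditional S),
    p.tsum_coe, ENNReal.toReal_one]

lemma mean_le_of_support [Finite S] (p : PMF S) (W : S → ℝ) (c : ℝ)
    (h : ∀ t, 0 < p t → W t ≤ c) : mean p W ≤ c := by
  have := Fintype.ofFinite S
  rw [mean, tsum_fintype]
  calc ∑ t, (p t).toReal * W t ≤ ∑ t, (p t).toReal * c := by
        refine Finset.sum_le_sum fun t _ => ?_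
        rcases eq_or_ne (p t) 0 with h0 | h0
        · simp [h0]
        · exact mul_le_mul_of_nonneg_left (h t (pos_iff_ne_zero.2 h0)) ENNReal.toReal_nonneg
    _ = c := by rw [← Finset.sum_mul, sum_toReal_pmf, one_mul]

lemma integral_toMeasure_eq_mean [Finite S] [MeasurableSpace S] [DiscreteMeasurableSpace S]
    (p : PMF S) (W : S → ℝ) : ∫ t, W t ∂p.toMeasure = mean p W := by
  have := Fintype.ofFinite S
  rw [PMF.integral_eq_sum, mean, tsum_fintype]
  rfl

lemma measurable_apply_nat [MeasurableSpace S] [DiscreteMeasurableSpace S] (g : S → ℝ) (n : ℕ) : Measurable fun ω : ℕ → S => g (ω n) :=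
  (Measurable.of_discrete (f := g)).comp (measurable_pi_apply n)

lemma integrable_of_abs_le [MeasurableSpace S] {μ : Measure (ℕ → S)} [IsProbabilityMeasure μ] {f : (ℕ → S) → ℝ}
    (hf : Measurable f) {M : ℝ} (hM : ∀ ω, |f ω| ≤ M) : Integrable f μ :=
  .of_bound hf.aestronglyMeasurable M (.of_forall hM)

lemma exists_abs_le [Finite S] (g : S → ℝ) : ∃ M, ∀ s, |g s| ≤ M := by
  obtain ⟨M, hM⟩ := (Set.finite_range fun s => |g s|).bddAbove
  exact ⟨M, fun s => hM ⟨s, rfl⟩⟩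

lemma infStates_nonempty [Finite S] (ω : ℕ → S) : (infStates ω).Nonempty := by
  by_contra h
  rw [Set.not_nonempty_iff_eq_empty] at h
  have h1 : ∀ t, ∀ᶠ n in atTop, ω n ≠ t := fun t => by
    by_contra hc
    exact (h ▸ (show t ∈ infStates ω from hc) : t ∈ (∅ : Set S))
  obtain ⟨n, hn⟩ := (eventually_all.2 h1).exists
  exact hn _ rfl

/-! ### Almost sure behaviour of plays and the supermartingale bound. -/

section Play

variable {G : MDP S}

/-- Distribution of the state at time `n + 1` given the play up to time `n`. -/
noncomputable def Strategy.law (σ : G.Strategy) (ω : ℕ → S) (n : ℕ) : PMF S :=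
  σ.step (List.ofFn fun i : Fin n => ω i) (ω n)

lemma Strategy.edge_of_step_pos (σ : G.Strategy) (w : List S) (s t : S) (h : 0 < σ.step w s t) :
    G.Edge s t := by
  unfold Strategy.step at h
  split_ifs at h with h1
  · exact σ.edge_of_pos w ⟨s, h1⟩ t h
  · exact (G.edge_iff ⟨s, h1⟩ t).2 h

lemma Excessive.mean_step_le [Finite S] {W : S → ℝ} (hW : G.Excessive W) (σ : G.Strategy)
    (w : List S) (s : S) : mean (σ.step w s) W ≤ W s := by
  by_cases h1 : s ∈ G.P1
  · exact mean_le_of_support _ _ _ fun t ht => hW.1 s h1 t (σ.edge_of_step_pos w s t ht)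
  · simpa only [Strategy.step, dif_neg h1] using hW.2 s h1

variable [Finite S] [MeasurableSpace S] [DiscreteMeasurableSpace S]

instance (σ : G.Strategy) (s : S) : IsProbabilityMeasure (σ.playMeasure s) := by
  unfold Strategy.playMeasure
  infer_instance

lemma integrable_apply_nat {μ : Measure (ℕ → S)} [IsProbabilityMeasure μ] (g : S → ℝ) (n : ℕ) :
    Integrable (fun ω => g (ω n)) μ := by
  obtain ⟨M, hM⟩ := exists_abs_le g
  exact integrable_of_abs_le (measurable_apply_nat g n) fun ω => hM (ω n)

open Filtration in
lemma Strategy.condExp_apply_succ (σ : G.Strategy) (s : S) (g : S → ℝ) (n : ℕ) :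
    (σ.playMeasure s)[fun ω => g (ω (n + 1)) | piLE n] =ᵐ[σ.playMeasure s]
      fun ω => mean (σ.law ω n) g := by
  refine (Kernel.condExp_traj (X := fun _ => S) (κ := σ.kernel) (x₀ := fun _ => s) (Nat.zero_le n)
    (integrable_apply_nat (μ := σ.playMeasure s) g (n + 1))).trans (.of_forall fun ω => ?_)
  have h := Kernel.map_traj_succ_self (X := fun _ => S) (κ := σ.kernel) (a := n)
  have h2 : (Kernel.traj σ.kernel n (Preorder.frestrictLe n ω)).map (fun x => x (n + 1)) =
      (σ.law ω n).toMeasure := by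
    rw [← Kernel.map_apply _ (measurable_pi_apply _), h]
    rfl
  dsimp only
  rw [← integral_toMeasure_eq_mean, ← h2, integral_map (measurable_pi_apply _).aemeasurable
    Measurable.of_discrete.aestronglyMeasurable]

open Filtration in
lemma measurable_piLE_of_dependsOn {β : Type*} [MeasurableSpace β] (n : ℕ) (f : (ℕ → S) → β)
    (F : (∀ _ : Set.Iic n, S) → β) (h : ∀ ω, f ω = F (fun i => ω i)) :
    Measurable[piLE (X := fun _ => S) n] f := by
  have : f = F ∘ Preorder.restrictLe n := funext h
  rw [this]
  exact Measurable.comp (.of_discrete (f := F)) (comap_measurable _)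

open Filtration in
lemma measurableSet_piLE_apply (n : ℕ) (A : Set S) :
    MeasurableSet[piLE (X := fun _ => S) n] {ω | ω n ∈ A} := by
  have := measurable_piLE_of_dependsOn n (fun ω : ℕ → S => ω n) (fun x => x ⟨n, Set.mem_Iic.2 le_rfl⟩)
    fun _ => rfl
  exact this (.of_discrete (s := A))

-- The event that `t` has conditional probability zero is known at time `n`; integrating the
-- conditional expectation over it shows that moving to `t` there is a null event.
open Filtration in
lemma Strategy.ae_law_pos (σ : G.Strategy) (s : S) :
    ∀ᵐ ω ∂σ.playMeasure s, ∀ n, 0 < σ.law ω n (ω (n + 1)) := by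
  rw [ae_all_iff]
  intro n
  have key : ∀ t : S, ∀ᵐ ω ∂σ.playMeasure s, ω (n + 1) = t → 0 < σ.law ω n t := by
    intro t
    set A : Set (ℕ → S) := {ω | σ.law ω n t = 0} with hA
    have hAm : MeasurableSet[piLE (X := fun _ => S) n] A := by
      have := measurable_piLE_of_dependsOn n (fun ω : ℕ → S => σ.law ω n t)
        (fun x => σ.step (List.ofFn fun i : Fin n => x ⟨i, Set.mem_Iic.2 i.2.le⟩) (x ⟨n, Set.mem_Iic.2 le_rfl⟩) t)
        fun _ => rfl
      exact this (measurableSet_singleton 0)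
    classical
    set g : S → ℝ := fun u => if u = t then 1 else 0
    have h1 := setIntegral_condExp (piLE.le n) (integrable_apply_nat (μ := σ.playMeasure s) g (n + 1))
      hAm
    have hm : ∀ ω, mean (σ.law ω n) g = (σ.law ω n t).toReal := by
      intro ω
      have := Fintype.ofFinite S
      simp [mean, tsum_fintype, g]
    have h2 : ∫ ω in A, g (ω (n + 1)) ∂σ.playMeasure s = 0 := by
      rw [← h1]
      rw [setIntegral_congr_ae (g := fun _ => 0) (piLE.le n _ hAm)]
      · simp
      · filter_upwards [σ.condExp_apply_succ s g n] with ω hω hωA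
        rw [hω, hm, show σ.law ω n t = 0 from hωA, ENNReal.toReal_zero]
    rw [setIntegral_eq_zero_iff_of_nonneg_ae
      (.of_forall fun ω => by simp only [g]; split_ifs <;> simp)
      (integrable_apply_nat g _).integrableOn] at h2
    rw [Filter.EventuallyEq, ae_restrict_iff' (piLE.le n _ hAm)] at h2
    filter_upwards [h2] with ω hω ht
    rw [pos_iff_ne_zero]
    intro h0
    have := hω h0
    simp [g, ht] at this
  filter_upwards [ae_all_iff.2 key] with ω hω using hω _ rfl

lemma Strategy.ae_edge (σ : G.Strategy) (s : S) :
    ∀ᵐ ω ∂σ.playMeasure s, ∀ n, G.Edge (ω n) (ω (n + 1)) := by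
  filter_upwards [σ.ae_law_pos s] with ω hω n using σ.edge_of_step_pos _ _ _ (hω n)

lemma Strategy.ae_apply_zero (σ : G.Strategy) (s : S) : ∀ᵐ ω ∂σ.playMeasure s, ω 0 = s := by
  have h := Kernel.traj_map_frestrictLe_apply (X := fun _ => S) (κ := σ.kernel) 0 0 (fun _ => s)
  rw [Kernel.partialTraj_self, Kernel.id_apply] at h
  have h2 : ∀ᵐ x ∂(σ.playMeasure s).map (Preorder.frestrictLe 0), x = fun _ => s := by
    rw [Strategy.playMeasure, h, ae_dirac_eq]
    exact eventually_pure.2 rfl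
  have h3 := ae_of_ae_map (Preorder.measurable_frestrictLe 0).aemeasurable h2
  filter_upwards [h3] with ω hω
  exact congrFun hω ⟨0, Finset.mem_Iic.2 le_rfl⟩

-- Lévy's conditional Borel–Cantelli lemma: each visit to `u` adds the fixed amount `c > 0` to the
-- sum of the conditional probabilities of moving to `t`, so infinitely many visits make that sum
-- diverge.
open Filtration in
lemma Strategy.ae_mem_infStates_of_edge (σ : G.Strategy) (s : S) (u : S) (hu : u ∉ G.P1) (t : S)
    (e : G.Edge u t) : ∀ᵐ ω ∂σ.playMeasure s, u ∈ infStates ω → t ∈ infStates ω := by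
  classical
  set c : ℝ := (G.δ ⟨u, hu⟩ t).toReal
  have hc : 0 < c := ENNReal.toReal_pos ((G.edge_iff ⟨u, hu⟩ t).1 e).ne' (PMF.apply_ne_top _ _)
  have h1 := ae_mem_limsup_atTop_iff (ℱ := piLE (X := fun _ => S)) (σ.playMeasure s)
    (s := fun n => {ω | ω n ∈ ({t} : Set S)}) fun n => measurableSet_piLE_apply n _
  have h2 := ae_all_iff.2 fun n => σ.condExp_apply_succ s (fun x => if x = t then 1 else 0) n
  filter_upwards [h1, h2] with ω hω1 hω2 hinf
  have hm : ∀ n, mean (σ.law ω n) (fun x => if x = t then 1 else 0) = (σ.law ω n t).toReal := by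
    intro n
    have := Fintype.ofFinite S
    simp [mean, tsum_fintype]
  have hset : ∀ n, ({ω | ω n ∈ ({t} : Set S)} : Set (ℕ → S)).indicator (1 : (ℕ → S) → ℝ) =
      fun ω => if ω n = t then 1 else 0 := by
    intro n
    ext ω
    simp [Set.indicator_apply]
  have h3 : ω ∈ limsup (fun n => {ω : ℕ → S | ω n ∈ ({t} : Set S)}) atTop := by
    rw [hω1]
    simp only [hset, hω2, hm]
    have hle : ∀ n, ∑ k ∈ Finset.range n, (if ω k = u then c else 0) ≤
        ∑ k ∈ Finset.range n, (σ.law ω k t).toReal := by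
      refine fun n => Finset.sum_le_sum fun k _ => ?_
      split_ifs with hk
      · refine le_of_eq ?_
        simp only [Strategy.law, Strategy.step, hk, dif_neg hu, c]
      · exact ENNReal.toReal_nonneg
    refine tendsto_atTop_mono hle ?_
    have h4 := Set.limsup_eq_tendsto_sum_indicator_atTop hc fun n => {ω : ℕ → S | ω n = u}
    have h5 : ω ∈ limsup (fun n => {ω : ℕ → S | ω n = u}) atTop := by
      rw [mem_limsup_iff_frequently_mem]
      exact hinf
    rw [h4] at h5
    simpa [Set.indicator_apply] using h5
  rw [mem_limsup_iff_frequently_mem] at h3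
  exact h3

/-- Almost surely, the states visited infinitely often form a set to which the MDP can be
restricted. -/
lemma Strategy.ae_isSub_infStates (σ : G.Strategy) (s : S) :
    ∀ᵐ ω ∂σ.playMeasure s, G.IsSub (infStates ω) := by
  have h1 : ∀ᵐ ω ∂σ.playMeasure s, ∀ u t, u ∉ G.P1 → G.Edge u t → u ∈ infStates ω →
      t ∈ infStates ω := by
    refine ae_all_iff.2 fun u => ae_all_iff.2 fun t => ?_
    by_cases h : u ∉ G.P1 ∧ G.Edge u t
    · filter_upwards [σ.ae_mem_infStates_of_edge s u h.1 t h.2] with ω hω _ _ using hω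
    · exact .of_forall fun ω hu e => absurd ⟨hu, e⟩ h
  filter_upwards [h1, σ.ae_edge s] with ω hω he
  refine ⟨fun u hu hp t e => hω u t hp e hu, fun u hu _ => ?_⟩
  by_contra! hc
  -- If no successor of `u` recurs, then from some time on no move out of `u` is possible: recurrent
  -- targets are not successors, and the others are no longer visited.
  have h2 : ∀ t, ∀ᶠ n in atTop, ω n = u → ω (n + 1) ≠ t := by
    intro t
    by_cases ht : t ∈ infStates ω
    · exact .of_forall fun n hn hn' => hc t ht (hn ▸ hn' ▸ he n)
    · have : ∀ᶠ n in atTop, ω n ≠ t := by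
        by_contra hh
        exact ht hh
      filter_upwards [(tendsto_add_atTop_nat 1).eventually this] with n hn _ using hn
  obtain ⟨n, hn, hn'⟩ := (Frequently.and_eventually hu (eventually_all.2 h2)).exists
  exact hn' _ hn rfl

open Filtration in
lemma Excessive.supermartingale {W : S → ℝ} (hW : G.Excessive W) (σ : G.Strategy) (s : S) :
    Supermartingale (fun n ω => W (ω n)) (piLE (X := fun _ => S)) (σ.playMeasure s) := by
  refine supermartingale_nat (fun n => ?_) (fun n => integrable_apply_nat W n) fun n => ?_
  · exact (measurable_piLE_of_dependsOn n (fun ω : ℕ → S => W (ω n)) (fun x => W (x ⟨n, Set.mem_Iic.2 le_rfl⟩))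
      fun _ => rfl).stronglyMeasurable
  · filter_upwards [σ.condExp_apply_succ s W n] with ω hω
    rw [hω]
    exact hW.mean_step_le σ _ _

/-- If a payoff is almost surely at most `W` infinitely often along the play, for an excessive
function `W`, then its expectation is at most the initial value of `W`. -/
lemma Excessive.integral_le {W : S → ℝ} (hW : G.Excessive W) (σ : G.Strategy) (s : S)
    {g : (ℕ → S) → ℝ} (hg : Integrable g (σ.playMeasure s))
    (h : ∀ᵐ ω ∂σ.playMeasure s, ∃ᶠ n in atTop, g ω ≤ W (ω n)) :
    ∫ ω, g ω ∂σ.playMeasure s ≤ W s := by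
  obtain ⟨M, hM⟩ := exists_abs_le W
  have hsup := hW.supermartingale σ s
  have hint : ∀ n, ∫ ω, W (ω n) ∂σ.playMeasure s ≤ W s := by
    intro n
    have h0 : ∫ ω, W (ω 0) ∂σ.playMeasure s = W s := by
      rw [integral_congr_ae (g := fun _ => W s)]
      · simp
      · filter_upwards [σ.ae_apply_zero s] with ω hω
        rw [hω]
    have := hsup.setIntegral_le (Nat.zero_le n) (MeasurableSet.univ)
    rw [setIntegral_univ, setIntegral_univ, h0] at this
    exact this
  -- Submartingale convergence for `-W`, which is bounded in `L¹` by `M`. Since `g ≤ W (ω n)`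
  -- infinitely often, `g` is below the limit `Z`, whose mean is the limit of means that are all at
  -- most `W s`.
  have hconv := hsup.neg.ae_tendsto_limitProcess (R := M.toNNReal) fun n => by
    have := eLpNorm_le_of_ae_bound (p := 1) (μ := σ.playMeasure s) (f := fun ω => W (ω n))
      (C := M) (.of_forall fun ω => hM (ω n))
    simpa [ENNReal.ofReal] using this
  set Z : (ℕ → S) → ℝ := fun ω => -(Filtration.limitProcess (-fun n ω => W (ω n))
    (Filtration.piLE (X := fun _ => S)) (σ.playMeasure s) ω)
  have hZ : ∀ᵐ ω ∂σ.playMeasure s, Tendsto (fun n => W (ω n)) atTop (nhds (Z ω)) := by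
    filter_upwards [hconv] with ω hω
    simpa using hω.neg
  have hlim := tendsto_integral_of_dominated_convergence (fun _ => M)
    (fun n => (measurable_apply_nat W n).aestronglyMeasurable) (integrable_const M)
    (fun n => .of_forall fun ω => hM (ω n)) hZ
  have hZint : Integrable Z (σ.playMeasure s) := by
    refine .of_bound (aestronglyMeasurable_of_tendsto_ae atTop
      (fun n => (measurable_apply_nat W n).aestronglyMeasurable) hZ) M ?_
    filter_upwards [hZ] with ω hω
    exact le_of_tendsto hω.norm (.of_forall fun n => hM (ω n))
  refine le_trans (integral_mono_ae hg hZint ?_) (le_of_tendsto' hlim hint)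
  filter_upwards [hZ, h] with ω hω hf
  exact ge_of_tendsto_of_frequently hω hf

end Play

/-! ### Decomposition of the play at its first step -/

/-- The sequences that agree with `x` up to time `n`. -/
def cyl (n : ℕ) (x : ℕ → S) : Set (ℕ → S) := {ω | ∀ i ≤ n, ω i = x i}

/-- The sequence that starts with `s` and continues with `ω`. -/
def consPlay (s : S) (ω : ℕ → S) : ℕ → S
  | 0 => s
  | n + 1 => ω n

lemma cyl_succ (n : ℕ) (x : ℕ → S) :
    cyl (n + 1) x = cyl n x ∩ {ω | ω (n + 1) = x (n + 1)} := by
  ext ω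
  simp only [cyl, Set.mem_ofPred_eq, Set.mem_inter_iff]
  constructor
  · exact fun h => ⟨fun i hi => h i (by omega), h _ le_rfl⟩
  · rintro ⟨h1, h2⟩ i hi
    rcases Nat.lt_or_ge n i with h | h
    · obtain rfl : i = n + 1 := by omega
      exact h2
    · exact h1 i h

lemma consPlay_preimage_cyl (s : S) (n : ℕ) (x : ℕ → S) (h : x 0 = s) :
    consPlay s ⁻¹' cyl (n + 1) x = cyl n fun i => x (i + 1) := by
  ext ω
  simp only [cyl, Set.mem_preimage, Set.mem_ofPred_eq]
  constructor
  · exact fun h i hi => h (i + 1) (by omega)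
  · rintro h' (_ | i) hi
    · exact h.symm
    · exact h' i (by omega)

lemma law_congr {G : MDP S} (σ : G.Strategy) {n : ℕ} {x ω : ℕ → S} (h : ω ∈ cyl n x) :
    σ.law ω n = σ.law x n := by
  have h1 : (List.ofFn fun i : Fin n => ω i) = List.ofFn fun i : Fin n => x i := by
    congr 1
    funext i
    exact h i i.2.le
  rw [Strategy.law, Strategy.law, h1, h n le_rfl]

variable {G : MDP S}

-- Makes every supremum over strategies one over a nonempty family, as `ciSup_le` requires.
open Classical in
instance (G : MDP S) : Nonempty G.Strategy :=
  ⟨{ next := fun _ s => PMF.pure (G.exists_edge s).choose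
     edge_of_pos := fun _ s t h => by
      rw [PMF.apply_pos_iff, PMF.support_pure] at h
      rw [Set.mem_singleton_iff.1 h]
      exact (G.exists_edge s).choose_spec }⟩

/-- The strategy that plays as `σ` does after the first state `s`. -/
noncomputable def Strategy.shift (σ : G.Strategy) (s : S) : G.Strategy where
  next w x := σ.next (s :: w) x
  edge_of_pos w x := σ.edge_of_pos (s :: w) x

lemma Strategy.law_consPlay_succ (σ : G.Strategy) (s : S) (ω : ℕ → S) (n : ℕ) :
    σ.law (consPlay s ω) (n + 1) = σ.step (s :: List.ofFn fun i : Fin n => ω i) (ω n) := by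
  rw [Strategy.law, List.ofFn_succ]
  rfl

lemma Strategy.law_shift (σ : G.Strategy) (s : S) (ω : ℕ → S) (n : ℕ) :
    σ.law (consPlay s ω) (n + 1) = (σ.shift s).law ω n := by
  rw [law_consPlay_succ]
  rfl

open Classical in
/-- The strategy that moves according to `p` in `s` at first, and then plays `τ t` from the
second state `t` on. -/
noncomputable def Strategy.glue (s : S) (p : PMF S) (hp : ∀ t, 0 < p t → G.Edge s t)
    (τ : S → G.Strategy) : G.Strategy where
  next
    -- For `x ≠ s` any legal move will do, since the play starts in `s`. With a history of length
    -- one, the current state is itself the second state and selects the continuation.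
    | [], x => if (x : S) = s then p else (τ s).next [] x
    | [_], x => (τ x).next [] x
    | _ :: y :: w, x => (τ y).next (y :: w) x
  edge_of_pos := by
    rintro (_ | ⟨a, _ | ⟨y, w⟩⟩) x t h
    · dsimp only at h
      split_ifs at h with hx
      · exact hx ▸ hp t h
      · exact (τ s).edge_of_pos _ _ _ h
    · exact (τ x).edge_of_pos _ _ _ h
    · exact (τ y).edge_of_pos _ _ _ h

lemma Strategy.law_glue (s : S) (p : PMF S) (hp : ∀ t, 0 < p t → G.Edge s t)
    (τ : S → G.Strategy) (ω : ℕ → S) (n : ℕ) :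
    (Strategy.glue s p hp τ).law (consPlay s ω) (n + 1) = (τ (ω 0)).law ω n := by
  rw [law_consPlay_succ]
  cases n with
  | zero => rfl
  | succ n =>
    rw [Strategy.law, List.ofFn_succ]
    rfl

lemma Strategy.step_glue (s : S) (p : PMF S) (hp : ∀ t, 0 < p t → G.Edge s t)
    (hδ : ∀ h : s ∉ G.P1, p = G.δ ⟨s, h⟩) (τ : S → G.Strategy) :
    (Strategy.glue s p hp τ).step [] s = p := by
  unfold Strategy.step
  split_ifs with h
  · simp [Strategy.glue]
  · exact (hδ h).symm

/-! ### The law of the play on cylinders, and one-step equations for values. -/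

section Measure

lemma measurable_consPlay [MeasurableSpace S] (s : S) : Measurable (consPlay s) := by
  refine measurable_pi_iff.2 ?_
  rintro (_ | n)
  · exact measurable_const
  · exact measurable_pi_apply n

lemma measurableSet_cyl [MeasurableSpace S] [MeasurableSingletonClass S] (n : ℕ) (x : ℕ → S) :
    MeasurableSet (cyl n x) := by
  have : cyl n x = ⋂ i, ⋂ (_ : i ≤ n), (fun ω : ℕ → S => ω i) ⁻¹' {x i} := by
    ext ω
    simp [cyl]
  rw [this]
  exact .iInter fun i => .iInter fun _ => measurable_pi_apply i (measurableSet_singleton _)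

/-- If a mean of numbers that are at most `c` is at least `c`, they are all `c` on the support. -/
lemma eq_of_le_mean [Finite S] {p : PMF S} {W : S → ℝ} {c : ℝ} (hW : ∀ t, W t ≤ c) (h : c ≤ mean p W) {t : S}
    (ht : 0 < p t) : W t = c := by
  have := Fintype.ofFinite S
  by_contra hne
  refine absurd h (not_le.2 ?_)
  rw [mean, tsum_fintype, ← one_mul c, ← sum_toReal_pmf p, Finset.sum_mul]
  refine Finset.sum_lt_sum (fun u _ => mul_le_mul_of_nonneg_left (hW u) ENNReal.toReal_nonneg)
    ⟨t, Finset.mem_univ t, ?_⟩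
  exact mul_lt_mul_of_pos_left (lt_of_le_of_ne (hW t) hne)
    (ENNReal.toReal_pos ht.ne' (p.apply_ne_top t))

lemma frequently_consPlay (s t : S) (ω : ℕ → S) :
    (∃ᶠ k in atTop, consPlay s ω k = t) ↔ ∃ᶠ k in atTop, ω k = t := by
  conv_lhs => rw [← map_add_atTop_eq_nat 1, frequently_map]
  rfl

lemma measurable_liminfObj [MeasurableSpace S] [DiscreteMeasurableSpace S] (r : S → ℝ) : Measurable (liminfObj r) :=
  Measurable.liminf fun i => measurable_apply_nat r i

lemma measurable_maxObj [MeasurableSpace S] [DiscreteMeasurableSpace S] (r : S → ℝ) : Measurable (maxObj r) :=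
  Measurable.iSup fun i => measurable_apply_nat r i

variable [Finite S] [MeasurableSpace S] [DiscreteMeasurableSpace S]

/-- The marginals on initial segments determine the measure, and on a finite discrete space they are
determined by point masses, whose preimages are cylinders. -/
lemma measure_ext_of_cyl {μ ν : Measure (ℕ → S)} [IsFiniteMeasure μ] [IsFiniteMeasure ν]
    (h : ∀ n x, μ (cyl n x) = ν (cyl n x)) : μ = ν := by
  have h1 : IsProjectiveLimit μ fun I : Finset ℕ => μ.map I.restrict := fun _ => rfl
  refine h1.unique ((isProjectiveLimit_nat_iff (X := fun _ => S) ?_ _).2 fun n => ?_)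
  · intro I J hJI
    rw [Measure.map_map (Finset.measurable_restrict₂ _) (Finset.measurable_restrict _)]
    rfl
  · refine Measure.ext_of_singleton fun y => ?_
    have h2 : (Preorder.frestrictLe (π := fun _ => S) n) ⁻¹' {y} =
        -- The truncation `min i n` only extends `y` to a full sequence; indices above `n` play no
        -- role.
        cyl n fun i => y ⟨min i n, Finset.mem_Iic.2 (min_le_right _ _)⟩ := by
      ext ω
      simp only [cyl, Set.mem_preimage, Set.mem_singleton_iff, Set.mem_ofPred_eq]
      constructor
      · rintro rfl i hi
        simp [hi]
      · intro hω
        funext i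
        have := hω i (Finset.mem_Iic.1 i.2)
        simpa [Finset.mem_Iic.1 i.2] using this
    rw [Measure.map_apply (Preorder.measurable_frestrictLe n) (measurableSet_singleton _), h2,
      ← h, ← h2]
    exact (Measure.map_apply (Preorder.measurable_frestrictLe n) (measurableSet_singleton _)).symm

open Classical in
lemma Strategy.playMeasure_cyl_zero (σ : G.Strategy) (s : S) (x : ℕ → S) :
    σ.playMeasure s (cyl 0 x) = if x 0 = s then 1 else 0 := by
  have h0 := σ.ae_apply_zero s
  split_ifs with h
  · refine (prob_compl_eq_zero_iff (measurableSet_cyl _ _)).1 ?_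
    refine measure_mono_null ?_ h0
    intro ω hω hs
    refine hω fun i hi => ?_
    obtain rfl : i = 0 := by omega
    exact hs.trans h.symm
  · refine measure_mono_null ?_ h0
    intro ω hω hs
    exact h ((hω 0 le_rfl).symm.trans hs)

lemma Strategy.playMeasure_cyl_eq_zero (σ : G.Strategy) {s : S} {x : ℕ → S} (h : x 0 ≠ s) (n : ℕ) :
    σ.playMeasure s (cyl n x) = 0 := by
  refine measure_mono_null (t := cyl 0 x) (fun ω hω i hi => hω i (by omega)) ?_
  rw [playMeasure_cyl_zero, if_neg h]

-- The cylinder belongs to the σ-algebra at time `n` and `law` is constant on it, so the defining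
-- property of conditional expectation becomes a product formula.
open Filtration in
lemma Strategy.playMeasure_cyl_succ (σ : G.Strategy) (s : S) (n : ℕ) (x : ℕ → S) :
    σ.playMeasure s (cyl (n + 1) x) = σ.playMeasure s (cyl n x) * σ.law x n (x (n + 1)) := by
  classical
  have hm : MeasurableSet[piLE (X := fun _ => S) n] (cyl n x) := by
    have : cyl n x = ⋂ i, ⋂ (_ : i ≤ n), {ω : ℕ → S | ω i ∈ ({x i} : Set S)} := by
      ext ω
      simp [cyl]
    rw [this]
    exact @MeasurableSet.iInter _ _ (piLE (X := fun _ => S) n) _ _ fun i =>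
      @MeasurableSet.iInter _ _ (piLE (X := fun _ => S) n) _ _ fun hi =>
      (piLE (X := fun _ => S)).mono hi _ (measurableSet_piLE_apply i _)
  set g : S → ℝ := fun u => if u = x (n + 1) then 1 else 0
  have hmean : ∀ ω, mean (σ.law ω n) g = (σ.law ω n (x (n + 1))).toReal := by
    intro ω
    have := Fintype.ofFinite S
    simp [mean, tsum_fintype, g]
  have h1 := setIntegral_condExp (piLE.le n) (integrable_apply_nat (μ := σ.playMeasure s) g (n + 1))
    hm
  rw [setIntegral_congr_ae (g := fun _ => (σ.law x n (x (n + 1))).toReal) (piLE.le n _ hm)] at h1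
  · have h2 : (fun ω : ℕ → S => g (ω (n + 1))) =
        ({ω | ω (n + 1) = x (n + 1)} : Set (ℕ → S)).indicator 1 := by
      ext ω
      simp [g, Set.indicator_apply]
    have h3 : MeasurableSet {ω : ℕ → S | ω (n + 1) = x (n + 1)} :=
      (measurableSet_singleton (x (n + 1))).preimage (measurable_pi_apply (n + 1))
    rw [h2, setIntegral_const, integral_indicator_one h3, measureReal_def, measureReal_def,
      Measure.restrict_apply h3, Set.inter_comm, ← cyl_succ, smul_eq_mul, ← ENNReal.toReal_mul,
      ENNReal.toReal_eq_toReal_iff' (ENNReal.mul_ne_top (measure_ne_top _ _)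
        (PMF.apply_ne_top _ _)) (measure_ne_top _ _)] at h1
    exact h1.symm
  · filter_upwards [σ.condExp_apply_succ s g n] with ω hω hωA
    rw [hω, hmean, law_congr σ hωA]

/-- Both sides agree on cylinders. Letting the continuation `τ` depend on the second state serves
two purposes: `shift` takes a given strategy apart, and `glue` assembles a new one. -/
lemma Strategy.playMeasure_eq_sum [Fintype S] (σ : G.Strategy) (s : S) (τ : S → G.Strategy)
    (h : ∀ ω n, σ.law (consPlay s ω) (n + 1) = (τ (ω 0)).law ω n) :
    σ.playMeasure s =
      ∑ t, σ.step [] s t • ((τ t).playMeasure t).map (consPlay s) := by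
  classical
  have hap : ∀ A, MeasurableSet A →
      (∑ t, σ.step [] s t • ((τ t).playMeasure t).map (consPlay s)) A =
      ∑ t, σ.step [] s t * (τ t).playMeasure t (consPlay s ⁻¹' A) := by
    intro A hA
    rw [Measure.finsetSum_apply]
    refine Finset.sum_congr rfl fun t _ => ?_
    rw [Measure.smul_apply, Measure.map_apply (measurable_consPlay s) hA, smul_eq_mul]
  have htot : ∑ t, σ.step [] s t = 1 := by
    rw [← tsum_fintype (L := .unconditional S), PMF.tsum_coe]
  have hfin : IsFiniteMeasure (∑ t, σ.step [] s t • ((τ t).playMeasure t).map (consPlay s)) := by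
    refine ⟨?_⟩
    rw [hap _ .univ]
    simp [htot]
  refine measure_ext_of_cyl fun n x => ?_
  rw [hap _ (measurableSet_cyl _ _)]
  by_cases hx : x 0 = s
  swap
  · rw [σ.playMeasure_cyl_eq_zero hx]
    refine (Finset.sum_eq_zero fun t _ => ?_).symm
    have : consPlay s ⁻¹' cyl n x = ∅ := by
      ext ω
      simp only [Set.mem_preimage, Set.mem_empty_iff_false, iff_false]
      exact fun hω => hx (hω 0 (Nat.zero_le _)).symm
    simp [this]
  have hxc : x = consPlay s fun i => x (i + 1) := by
    funext i
    cases i with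
    | zero => exact hx
    | succ i => rfl
  induction n with
  | zero =>
    have : consPlay s ⁻¹' cyl 0 x = Set.univ := by
      ext ω
      simp only [Set.mem_preimage, Set.mem_univ, iff_true]
      intro i hi
      obtain rfl : i = 0 := by omega
      exact hx.symm
    rw [playMeasure_cyl_zero, if_pos hx]
    simp [this, htot]
  | succ n ih =>
    rw [playMeasure_cyl_succ, ih]
    -- The first transition produces the weights and is treated apart; later ones multiply each
    -- summand by the same factor, summands with `t ≠ x 1` being zero.
    cases n with
    | zero =>
      have h0 : consPlay s ⁻¹' cyl 0 x = Set.univ := by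
        ext ω
        simp only [Set.mem_preimage, Set.mem_univ, iff_true]
        intro i hi
        obtain rfl : i = 0 := by omega
        exact hx.symm
      simp only [h0, measure_univ, mul_one, htot, one_mul, consPlay_preimage_cyl s 0 x hx,
        playMeasure_cyl_zero]
      simp [Strategy.law, hx]
    | succ n =>
      rw [Finset.sum_mul]
      refine Finset.sum_congr rfl fun t _ => ?_
      rw [consPlay_preimage_cyl s n x hx, consPlay_preimage_cyl s (n + 1) x hx,
        playMeasure_cyl_succ, mul_assoc]
      congr 1
      by_cases ht : x 1 = t
      · conv_lhs => rw [hxc, h]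
        subst ht
        rfl
      · rw [(τ t).playMeasure_cyl_eq_zero (x := fun i => x (i + 1)) ht]
        simp

lemma Strategy.integral_eq_mean (σ : G.Strategy) (s : S) (τ : S → G.Strategy)
    (h : ∀ ω n, σ.law (consPlay s ω) (n + 1) = (τ (ω 0)).law ω n) {f : (ℕ → S) → ℝ}
    (hf : Measurable f) {M : ℝ} (hM : ∀ ω, |f ω| ≤ M) :
    ∫ ω, f ω ∂σ.playMeasure s =
      mean (σ.step [] s) fun t => ∫ ω, f (consPlay s ω) ∂(τ t).playMeasure t := by
  have := Fintype.ofFinite S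
  have hi : ∀ t, Integrable f (((τ t).playMeasure t).map (consPlay s)) := fun t => by
    have := Measure.isProbabilityMeasure_map (μ := (τ t).playMeasure t)
      (measurable_consPlay s).aemeasurable
    exact integrable_of_abs_le hf hM
  rw [σ.playMeasure_eq_sum s τ h, integral_finsetSum_measure fun t _ =>
    (hi t).smul_measure (PMF.apply_ne_top _ _), mean, tsum_fintype]
  refine Finset.sum_congr rfl fun t _ => ?_
  rw [integral_smul_measure, integral_map (measurable_consPlay s).aemeasurable
    hf.aestronglyMeasurable, smul_eq_mul]

/-! ### Values -/

/-- Reconciles the σ-algebra `⊤` built into `expect` with an arbitrary discrete one. -/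
lemma Strategy.expect_eq_integral (σ : G.Strategy) (s : S) (f : (ℕ → S) → ℝ) :
    σ.expect s f = ∫ ω, f ω ∂σ.playMeasure s := by
  obtain rfl : ‹MeasurableSpace S› = ⊤ := by
    ext A
    exact iff_of_true .of_discrete trivial
  rfl

lemma Strategy.prob_eq_measureReal (σ : G.Strategy) (s : S) (A : Set (ℕ → S)) :
    σ.prob s A = (σ.playMeasure s).real A := by
  obtain rfl : ‹MeasurableSpace S› = ⊤ := by
    ext A
    exact iff_of_true .of_discrete trivial
  rfl

lemma Strategy.expect_le {f : (ℕ → S) → ℝ} {M : ℝ} (hM : ∀ ω, |f ω| ≤ M) (σ : G.Strategy)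
    (s : S) : σ.expect s f ≤ M := by
  rw [σ.expect_eq_integral]
  refine (le_abs_self _).trans ?_
  have := norm_integral_le_of_norm_le_const (f := f) (μ := σ.playMeasure s) (C := M) (.of_forall hM)
  simpa using this

lemma bddAbove_expect {f : (ℕ → S) → ℝ} {M : ℝ} (hM : ∀ ω, |f ω| ≤ M) (s : S) :
    BddAbove (Set.range fun σ : G.Strategy => σ.expect s f) :=
  ⟨M, by rintro _ ⟨σ, rfl⟩; exact σ.expect_le hM s⟩

lemma Strategy.expect_le_value {f : (ℕ → S) → ℝ} {M : ℝ} (hM : ∀ ω, |f ω| ≤ M) (σ : G.Strategy)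
    (s : S) : σ.expect s f ≤ G.value f s :=
  le_ciSup (bddAbove_expect hM s) σ

/-- Glue `ε`-optimal strategies from all successors; by `hc` the extra initial state costs nothing.
A general legal `p` covers both a Dirac move of the player and `δ`. -/
lemma mean_value_le {f : (ℕ → S) → ℝ} (hf : Measurable f) {M : ℝ} (hM : ∀ ω, |f ω| ≤ M)
    (hc : ∀ s ω, f ω ≤ f (consPlay s ω)) (s : S) (p : PMF S) (hp : ∀ t, 0 < p t → G.Edge s t)
    (hδ : ∀ h : s ∉ G.P1, p = G.δ ⟨s, h⟩) : mean p (G.value f) ≤ G.value f s := by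
  refine le_of_forall_pos_le_add fun ε hε => ?_
  have hτ : ∀ t, ∃ τ : G.Strategy, G.value f t - ε < τ.expect t f := fun t =>
    exists_lt_of_lt_ciSup (sub_lt_self _ hε)
  choose τ hτ using hτ
  have := Fintype.ofFinite S
  calc mean p (G.value f)
      ≤ mean p (fun t => ∫ ω, f (consPlay s ω) ∂(τ t).playMeasure t) + ε := by
        rw [mean, mean, tsum_fintype, tsum_fintype, ← one_mul ε, ← sum_toReal_pmf p,
          Finset.sum_mul, ← Finset.sum_add_distrib]
        refine Finset.sum_le_sum fun t _ => ?_
        rw [← mul_add]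
        refine mul_le_mul_of_nonneg_left ?_ ENNReal.toReal_nonneg
        have h1 : (τ t).expect t f ≤ ∫ ω, f (consPlay s ω) ∂(τ t).playMeasure t := by
          rw [Strategy.expect_eq_integral]
          exact integral_mono (integrable_of_abs_le hf hM)
            (integrable_of_abs_le (hf.comp (measurable_consPlay s)) fun ω => hM _)
            fun ω => hc s ω
        linarith [hτ t]
    _ = (Strategy.glue s p hp τ).expect s f + ε := by
        rw [Strategy.expect_eq_integral, Strategy.integral_eq_mean _ s τ
          (Strategy.law_glue s p hp τ) hf hM, Strategy.step_glue s p hp hδ]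
    _ ≤ G.value f s + ε := by
        gcongr
        exact Strategy.expect_le_value hM _ s

lemma mean_pure (t : S) (W : S → ℝ) : mean (PMF.pure t) W = W t := by
  rw [← integral_toMeasure_eq_mean, PMF.toMeasure_pure, integral_dirac]

/-- If a longer play never pays less, then the value is excessive. -/
lemma excessive_value {f : (ℕ → S) → ℝ} (hf : Measurable f) {M : ℝ} (hM : ∀ ω, |f ω| ≤ M)
    (hc : ∀ s ω, f ω ≤ f (consPlay s ω)) : G.Excessive (G.value f) := by
  refine ⟨fun s hs t e => ?_, fun s hs => ?_⟩
  · rw [← mean_pure t (G.value f)]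
    refine mean_value_le hf hM hc s _ (fun u hu => ?_) fun h => absurd hs h
    rw [PMF.apply_pos_iff, PMF.support_pure] at hu
    exact Set.mem_singleton_iff.1 hu ▸ e
  · exact mean_value_le hf hM hc s _ (fun t => (G.edge_iff ⟨s, hs⟩ t).2) fun _ => rfl

/-- What remains of a strategy after its first state is again a strategy, hence earns at most the
value at the successor. -/
lemma value_le_mean {f : (ℕ → S) → ℝ} (hf : Measurable f) {M : ℝ} (hM : ∀ ω, |f ω| ≤ M)
    (hc : ∀ s ω, f (consPlay s ω) ≤ f ω) (s : S) (hs : s ∉ G.P1) :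
    G.value f s ≤ mean (G.δ ⟨s, hs⟩) (G.value f) := by
  have := Fintype.ofFinite S
  refine ciSup_le fun σ => ?_
  rw [σ.expect_eq_integral, σ.integral_eq_mean s (fun _ => σ.shift s) (σ.law_shift s) hf hM,
    show σ.step [] s = G.δ ⟨s, hs⟩ from dif_neg hs, mean, mean, tsum_fintype, tsum_fintype]
  refine Finset.sum_le_sum fun t _ => mul_le_mul_of_nonneg_left ?_ ENNReal.toReal_nonneg
  refine le_trans ?_ ((σ.shift s).expect_le_value hM t)
  rw [Strategy.expect_eq_integral]
  exact integral_mono (integrable_of_abs_le (hf.comp (measurable_consPlay s)) fun ω => hM _)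
    (integrable_of_abs_le hf hM) fun ω => hc s ω

/-! ### The objectives -/

lemma measurableSet_coBuchi (C : Set S) : MeasurableSet (coBuchi C) := by
  have h1 : coBuchi C = ⋂ t, ⋂ (_ : t ∉ C), {ω : ℕ → S | ∃ᶠ k in atTop, ω k = t}ᶜ := by
    ext ω
    simp only [coBuchi, infStates, Set.mem_ofPred_eq, Set.mem_iInter, Set.mem_compl_iff]
    exact ⟨fun h t ht hf => ht (h hf), fun h t hf => by_contra fun ht => h t ht hf⟩
  have h2 : ∀ t, {ω : ℕ → S | ∃ᶠ k in atTop, ω k = t} =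
      limsup (fun k => {ω : ℕ → S | ω k = t}) atTop := by
    intro t
    ext ω
    rw [mem_limsup_iff_frequently_mem]
    rfl
  rw [h1]
  refine .iInter fun t => .iInter fun _ => ?_
  rw [h2]
  exact (MeasurableSet.measurableSet_limsup fun k =>
    (measurableSet_singleton t).preimage (measurable_pi_apply k)).compl

lemma qualValue_eq_value (C : Set S) :
    G.qualValue (coBuchi C) = G.value ((coBuchi C).indicator 1) := by
  ext s
  refine iSup_congr fun σ => ?_
  rw [σ.expect_eq_integral, integral_indicator_one (measurableSet_coBuchi C),
    σ.prob_eq_measureReal]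

lemma abs_indicator_one_le {Ω : Type*} (A : Set Ω) (ω : Ω) : |A.indicator (1 : Ω → ℝ) ω| ≤ 1 := by
  by_cases h : ω ∈ A <;> simp [h]

/-- The successors of a probabilistic state of value one have value one. -/
lemma mem_winOne_of_edge {C : Set S} {s t : S} (hs : s ∉ G.P1) (h : s ∈ G.winOne (coBuchi C))
    (e : G.Edge s t) : t ∈ G.winOne (coBuchi C) := by
  have hM := abs_indicator_one_le (coBuchi C)
  have hm : Measurable ((coBuchi C).indicator (1 : (ℕ → S) → ℝ)) :=
    measurable_one.indicator (measurableSet_coBuchi C)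
  have h1 := value_le_mean (G := G) hm hM (fun u ω => by
    have : (consPlay u ω ∈ coBuchi C) ↔ ω ∈ coBuchi C := by
      simp only [coBuchi, infStates, frequently_consPlay, Set.mem_ofPred_eq]
    by_cases hω : ω ∈ coBuchi C
    · simp [hω, this.2 hω]
    · simp [hω, mt this.1 hω]) s hs
  have h2 : G.value ((coBuchi C).indicator 1) s = 1 := by
    rw [← qualValue_eq_value]
    exact h
  rw [h2] at h1
  have h3 := eq_of_le_mean (fun u => ciSup_le fun σ => σ.expect_le hM u) h1
    ((G.edge_iff ⟨s, hs⟩ t).1 e)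
  change G.qualValue (coBuchi C) t = 1
  rw [qualValue_eq_value]
  exact h3

end Measure

/-! ### Recurrent states and the liminf objective -/

lemma eventually_mem_infStates [Finite S] (ω : ℕ → S) : ∀ᶠ n in atTop, ω n ∈ infStates ω := by
  have h : ∀ t, ∀ᶠ n in atTop, ω n = t → t ∈ infStates ω := fun t => by
    by_cases ht : t ∈ infStates ω
    · exact .of_forall fun _ _ => ht
    · filter_upwards [not_frequently.1 ht] with n hn hn' using absurd hn' hn
  filter_upwards [eventually_all.2 h] with n hn using hn _ rfl

lemma infStates_subset {ω : ℕ → S} {C : Set S} (h : ∀ n, ω n ∈ C) : infStates ω ⊆ C := by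
  intro t ht
  obtain ⟨n, hn⟩ := Frequently.exists ht
  exact hn ▸ h n

/-- The liminf payoff is the least reward of the states visited infinitely often. -/
lemma exists_liminfObj_eq [Finite S] (r : S → ℝ) (ω : ℕ → S) :
    ∃ t ∈ infStates ω, liminfObj r ω = r t ∧ ∀ u ∈ infStates ω, r t ≤ r u := by
  obtain ⟨t, ht, hmin⟩ := (infStates ω).toFinite.exists_minimalFor r _ (infStates_nonempty ω)
  have hmin' : ∀ u ∈ infStates ω, r t ≤ r u := fun u hu =>
    (le_total (r t) (r u)).elim id fun h => hmin hu h
  obtain ⟨M, hM⟩ := exists_abs_le r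
  have hlow : IsBoundedUnder (· ≥ ·) atTop fun i => r (ω i) :=
    isBoundedUnder_of ⟨-M, fun n => (abs_le.1 (hM (ω n))).1⟩
  have hup : IsCoboundedUnder (· ≥ ·) atTop fun i => r (ω i) :=
    (isBoundedUnder_of ⟨M, fun n => (abs_le.1 (hM (ω n))).2⟩ :
      IsBoundedUnder (· ≤ ·) atTop fun i => r (ω i)).isCoboundedUnder_ge
  refine ⟨t, ht, le_antisymm ?_ ?_, hmin'⟩
  · exact liminf_le_of_frequently_le (Frequently.mono ht fun n hn => (congrArg r hn).le) hlow
  · exact le_liminf_of_le hup ((eventually_mem_infStates ω).mono fun n hn => hmin' _ hn)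

lemma abs_liminfObj_le [Finite S] {r : S → ℝ} {M : ℝ} (hM : ∀ s, |r s| ≤ M) (ω : ℕ → S) :
    |liminfObj r ω| ≤ M := by
  obtain ⟨t, -, h, -⟩ := exists_liminfObj_eq r ω
  exact h ▸ hM t

lemma liminfObj_consPlay (r : S → ℝ) (s : S) (ω : ℕ → S) :
    liminfObj r (consPlay s ω) = liminfObj r ω :=
  (Filter.liminf_nat_add (fun i => r (consPlay s ω i)) 1).symm

lemma exists_maxObj_eq [Finite S] (r : S → ℝ) (ω : ℕ → S) : ∃ k, maxObj r ω = r (ω k) := by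
  have hf : (Set.range fun i => r (ω i)).Finite :=
    (Set.finite_range r).subset (by rintro _ ⟨i, rfl⟩; exact ⟨ω i, rfl⟩)
  obtain ⟨k, hk⟩ := (Set.range_nonempty fun i => r (ω i)).csSup_mem hf
  exact ⟨k, hk.symm⟩

lemma le_maxObj [Finite S] (r : S → ℝ) (ω : ℕ → S) (k : ℕ) : r (ω k) ≤ maxObj r ω := by
  refine le_ciSup (f := fun i => r (ω i)) ?_ k
  exact ((Set.finite_range r).subset (by rintro _ ⟨i, rfl⟩; exact ⟨ω i, rfl⟩)).bddAbove

lemma abs_maxObj_le [Finite S] {r : S → ℝ} {M : ℝ} (hM : ∀ s, |r s| ≤ M) (ω : ℕ → S) :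
    |maxObj r ω| ≤ M := by
  obtain ⟨k, h⟩ := exists_maxObj_eq r ω
  exact h ▸ hM _

lemma maxObj_le_consPlay [Finite S] (r : S → ℝ) (s : S) (ω : ℕ → S) :
    maxObj r ω ≤ maxObj r (consPlay s ω) := by
  obtain ⟨k, h⟩ := exists_maxObj_eq r ω
  exact h ▸ le_maxObj r (consPlay s ω) (k + 1)

/-! ### Lower bounds on values, in particular from strategies that stay in a set. -/

section Values

variable [Finite S] [MeasurableSpace S] [DiscreteMeasurableSpace S]

lemma excessive_value_liminfObj (r : S → ℝ) : G.Excessive (G.value (liminfObj r)) :=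
  have ⟨_, hM⟩ := exists_abs_le r
  excessive_value (measurable_liminfObj r) (abs_liminfObj_le hM)
    fun s ω => (liminfObj_consPlay r s ω).ge

lemma excessive_value_maxObj (r : S → ℝ) : G.Excessive (G.value (maxObj r)) :=
  have ⟨_, hM⟩ := exists_abs_le r
  excessive_value (measurable_maxObj r) (abs_maxObj_le hM) (maxObj_le_consPlay r)

lemma le_value_maxObj (r : S → ℝ) (s : S) : r s ≤ G.value (maxObj r) s := by
  obtain ⟨M, hM⟩ := exists_abs_le r
  obtain ⟨σ⟩ : Nonempty G.Strategy := inferInstance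
  refine le_trans ?_ (σ.expect_le_value (abs_maxObj_le hM) s)
  have h : ∫ _, r s ∂σ.playMeasure s = r s := by simp
  rw [σ.expect_eq_integral, ← h]
  refine integral_mono_ae (integrable_const _)
    (integrable_of_abs_le (measurable_maxObj r) (abs_maxObj_le hM)) ?_
  filter_upwards [σ.ae_apply_zero s] with ω hω
  exact hω ▸ le_maxObj r ω 0

open Classical in
/-- The player can surely stay forever in a set to which the MDP can be restricted. -/
lemma IsSub.exists_strategy {C : Set S} (hC : G.IsSub C) :
    ∃ σ : G.Strategy, ∀ s ∈ C, ∀ᵐ ω ∂σ.playMeasure s, ∀ n, ω n ∈ C := by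
  have hsucc : ∀ s : G.P1, ∃ t, G.Edge s t ∧ ((s : S) ∈ C → t ∈ C) := by
    intro s
    by_cases h : (s : S) ∈ C
    · obtain ⟨t, ht, e⟩ := hC.2 s h s.2
      exact ⟨t, e, fun _ => ht⟩
    · obtain ⟨t, e⟩ := G.exists_edge s
      exact ⟨t, e, fun h' => absurd h' h⟩
  choose φ hφ hφC using hsucc
  have hpos : ∀ s t, 0 < PMF.pure (φ s) t → t = φ s := by
    intro s t h
    rw [PMF.apply_pos_iff, PMF.support_pure] at h
    exact h
  refine ⟨⟨fun _ s => PMF.pure (φ s), fun _ s t h => (hpos s t h) ▸ hφ s⟩, fun s hs => ?_⟩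
  filter_upwards [Strategy.ae_law_pos _ s, Strategy.ae_edge _ s, Strategy.ae_apply_zero _ s]
    with ω hω he h0 n
  induction n with
  | zero => exact h0 ▸ hs
  | succ n ih =>
    by_cases h1 : ω n ∈ G.P1
    · have := hω n
      simp only [Strategy.law, Strategy.step, dif_pos h1] at this
      exact hpos _ _ this ▸ hφC ⟨ω n, h1⟩ ih
    · exact hC.1 _ ih h1 _ (he n)

lemma IsSub.le_value_liminfObj {C : Set S} (hC : G.IsSub C) {r : S → ℝ} {v : ℝ}
    (hv : ∀ t ∈ C, v ≤ r t) {s : S} (hs : s ∈ C) : v ≤ G.value (liminfObj r) s := by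
  obtain ⟨M, hM⟩ := exists_abs_le r
  obtain ⟨σ, hσ⟩ := hC.exists_strategy
  refine le_trans ?_ (σ.expect_le_value (abs_liminfObj_le hM) s)
  have h : ∫ _, v ∂σ.playMeasure s = v := by simp
  rw [σ.expect_eq_integral, ← h]
  refine integral_mono_ae (integrable_const _)
    (integrable_of_abs_le (measurable_liminfObj r) (abs_liminfObj_le hM)) ?_
  filter_upwards [hσ s hs] with ω hω
  obtain ⟨t, ht, h, -⟩ := exists_liminfObj_eq r ω
  exact h ▸ hv t (infStates_subset hω ht)

lemma IsSub.subset_winOne {C D : Set S} (hC : G.IsSub C) (hCD : C ⊆ D) :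
    C ⊆ G.winOne (coBuchi D) := by
  intro s hs
  obtain ⟨σ, hσ⟩ := hC.exists_strategy
  have h1 : σ.prob s (coBuchi D) = 1 := by
    rw [σ.prob_eq_measureReal, measureReal_def, (mem_ae_iff_prob_eq_one
      (measurableSet_coBuchi D)).1, ENNReal.toReal_one]
    filter_upwards [hσ s hs] with ω hω using (infStates_subset hω).trans hCD
  have hle : ∀ σ : G.Strategy, σ.prob s (coBuchi D) ≤ 1 := fun σ => by
    rw [σ.prob_eq_measureReal]
    exact measureReal_le_one
  refine le_antisymm (ciSup_le hle) ?_
  rw [← h1]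
  exact le_ciSup (f := fun σ : G.Strategy => σ.prob s (coBuchi D))
    ⟨1, by rintro _ ⟨τ, rfl⟩; exact hle τ⟩ σ

lemma value_liminfObj_nonneg {r : S → ℝ} (hr : ∀ s, 0 < r s) (s : S) :
    0 ≤ G.value (liminfObj r) s :=
  G.isSub_univ.le_value_liminfObj (fun t _ => (hr t).le) (Set.mem_univ s)

end Values

/-! ### Sub-MDPs and copies -/

/-- One can descend through the attractor stages without leaving `C`: a probabilistic state has all
its successors in `C`, and a player-1 state has one there, which lies in the previous stage. Hence a
`C` that misses `U` survives the removal of the attractor. -/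
lemma IsSub.inter_nonempty_of_attr {C U : Set S} (hC : G.IsSub C) (h : (C ∩ G.attr U).Nonempty) :
    (C ∩ U).Nonempty := by
  obtain ⟨s, hsC, hs⟩ := h
  obtain ⟨i, hi⟩ := Set.mem_iUnion.1 hs
  clear hs
  induction i generalizing s with
  | zero => exact ⟨s, hsC, hi⟩
  | succ i ih =>
    rcases hi with (hi | ⟨h1, t, e, ht⟩) | ⟨h1, ht⟩
    · exact ih s hsC hi
    · exact ih t (hC.1 s hsC h1 t e) ht
    · obtain ⟨t, htC, e⟩ := hC.2 s hsC h1
      exact ih t htC (ht t e)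

lemma subset_attr (U : Set S) : U ⊆ G.attr U := fun _ hs => Set.mem_iUnion.2 ⟨0, hs⟩

lemma IsSub.preimage_val {X C : Set S} (hX : G.IsSub X) (hC : G.IsSub C) (hCX : C ⊆ X) :
    (G.restrict X hX).IsSub (Subtype.val ⁻¹' C) := by
  refine ⟨fun s hs h1 t e => hC.1 s hs h1 t e, fun s hs h1 => ?_⟩
  obtain ⟨t, ht, e⟩ := hC.2 s hs h1
  exact ⟨⟨t, hCX ht⟩, ht, e⟩

lemma Excessive.restrict {W : S → ℝ} (hW : G.Excessive W) {X : Set S} (hX : G.IsSub X) :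
    (G.restrict X hX).Excessive fun s => W s := by
  refine ⟨fun s hs t e => hW.1 s hs t e, fun s hs => le_trans (le_of_eq ?_) (hW.2 s hs)⟩
  refine tsum_subtype_eq_of_support_subset (s := X)
    (f := fun t => (G.δ ⟨s, hs⟩ t).toReal * W t) fun t ht => ?_
  refine hX.1 s s.2 hs t ((G.edge_iff ⟨s, hs⟩ t).2 (pos_iff_ne_zero.2 fun h0 => ht ?_))
  simp [h0]

lemma mean_map {T : Type*} [Finite S] [Finite T] (p : PMF S) (f : S → T) (W : T → ℝ) :
    mean (p.map f) W = mean p (W ∘ f) := by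
  let _ : MeasurableSpace S := ⊤
  let _ : MeasurableSpace T := ⊤
  rw [← integral_toMeasure_eq_mean, ← integral_toMeasure_eq_mean,
    ← PMF.toMeasure_map f p Measurable.of_discrete,
    integral_map Measurable.of_discrete.aemeasurable Measurable.of_discrete.aestronglyMeasurable]
  rfl

lemma excessive_addCopies_iff [Finite S] {A : Set S} (hA : A ⊆ G.P1) {W : S ⊕ ↥A → ℝ} :
    (G.addCopies A hA).Excessive W ↔
      G.Excessive (W ∘ Sum.inl) ∧ ∀ a : A, W (.inr a) ≤ W (.inl a) := by
  have hP : ∀ s, Sum.inl s ∉ (G.addCopies A hA).P1 ↔ s ∉ G.P1 := by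
    intro s
    refine not_congr ⟨?_, fun h => Or.inl ⟨s, h, rfl⟩⟩
    rintro (⟨t, ht, h⟩ | ⟨a, h⟩)
    · exact Sum.inl.inj h ▸ ht
    · exact absurd h Sum.inr_ne_inl
  constructor
  · refine fun h => ⟨⟨fun s hs t e => h.1 _ (Or.inl ⟨s, hs, rfl⟩) _ (.old e), fun s hs => ?_⟩,
      fun a => h.1 _ (Or.inl ⟨a, hA a.2, rfl⟩) _ (.toCopy a)⟩
    rw [← mean_map]
    exact h.2 (Sum.inl s) ((hP s).2 hs)
  · rintro ⟨h1, h2⟩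
    refine ⟨fun s hs t e => ?_, ?_⟩
    · cases e with
      | @old s t e => exact h1.1 s (by_contra fun h => (hP s).2 h hs) t e
      | toCopy a => exact h2 a
      | loop a => exact le_rfl
    · rintro (s | a) hs
      · refine (mean_map (G.δ ⟨s, (hP s).1 hs⟩) Sum.inl W).trans_le (h1.2 s _)
      · exact (hs (Or.inr ⟨a, rfl⟩)).elim

/-! ### The algorithm -/

section Algorithm

variable [Finite S]

/-- Later value-one sets consist of live states, so a removed state keeps its `fstar`. -/
lemma limInfStep_persist (r : S → ℝ) (st : G.LimInfState) (v : ℝ) {a : S} (ha : a ∈ st.Sstar)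
    (hl : a ∉ st.live) : a ∈ (G.limInfStep r st v).Sstar ∧ a ∉ (G.limInfStep r st v).live ∧
      (G.limInfStep r st v).fstar a = st.fstar a := by
  refine ⟨Or.inl ha, ?_, if_neg ?_⟩
  · rintro ⟨b, -, rfl⟩
    exact hl b.2
  · rintro ⟨⟨b, -, rfl⟩, -⟩
    exact hl b.2

/-- A set to which `G` can be restricted and which meets the value-one set contains a player-1
state that gets the current value. -/
lemma limInfStep_hit (hG : G.IsBipartite) (r : S → ℝ) (st : G.LimInfState) (v : ℝ) {C : Set S}
    (hC : G.IsSub C) {u : ↥st.live} (huC : (u : S) ∈ C) (hu : u ∈ st.winSet r v) :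
    ∃ a ∈ C, a ∈ (G.limInfStep r st v).Sstar ∧ a ∉ (G.limInfStep r st v).live ∧
      (G.limInfStep r st v).fstar a = v := by
  obtain ⟨a, haC, haU, ha1⟩ : ∃ a : ↥st.live, (a : S) ∈ C ∧ a ∈ st.winSet r v ∧
      (a : S) ∈ G.P1 := by
    by_cases h1 : (u : S) ∈ G.P1
    · exact ⟨u, huC, hu, h1⟩
    -- By bipartiteness the successor is a player-1 state; it stays in `C` and in the value-one set
    -- because `u` is probabilistic.
    · obtain ⟨t, e⟩ := st.cur.exists_edge u
      let _ : MeasurableSpace S := ⊤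
      exact ⟨t, hC.1 u huC h1 t e, mem_winOne_of_edge (G := st.cur) h1 hu e,
        ((hG u t e).resolve_left fun h => h1 h.1).2⟩
  have ha : (a : S) ∈ Subtype.val '' st.winSet r v ∩ G.P1 := ⟨⟨a, haU, rfl⟩, ha1⟩
  refine ⟨a, haC, Or.inr ha, ?_, if_pos ha⟩
  rintro ⟨b, hb, hba⟩
  exact hb (subset_attr _ (Subtype.ext hba ▸ haU))

/-- Loop invariant: either `C` is entirely live and `L` is still to come, or some `a ∈ C` has been
removed with `fstar a ≥ L`. Rewards decrease, so a value assigned before `L` is reached is at least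
`L`. -/
lemma exists_mem_Sstar_foldl (hG : G.IsBipartite) (r : S → ℝ) {C : Set S} (hC : G.IsSub C)
    (hne : C.Nonempty) {L : ℝ} (hL : ∀ t ∈ C, L ≤ r t) (l : List ℝ) (hl : l.Pairwise (· ≥ ·))
    (st : G.LimInfState) (h : (L ∈ l ∧ C ⊆ st.live) ∨
      ∃ a ∈ C, a ∈ st.Sstar ∧ a ∉ st.live ∧ L ≤ st.fstar a) :
    ∃ a ∈ C, a ∈ (l.foldl (G.limInfStep r) st).Sstar ∧
      L ≤ (l.foldl (G.limInfStep r) st).fstar a := by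
  induction l generalizing st with
  | nil =>
    rcases h with ⟨h, -⟩ | ⟨a, h1, h2, -, h3⟩
    · exact absurd h List.not_mem_nil
    · exact ⟨a, h1, h2, h3⟩
  | cons v l ih =>
    refine ih hl.of_cons _ ?_
    rcases h with ⟨hLl, hlive⟩ | ⟨a, h1, h2, h3, h4⟩
    · have hLv : L ≤ v := by
        rcases List.mem_cons.1 hLl with rfl | h
        · exact le_rfl
        · exact List.rel_of_pairwise_cons hl h
      have hCsub := st.isSub.preimage_val hC hlive
      by_cases hmeet : ∃ u : ↥st.live, (u : S) ∈ C ∧ u ∈ st.winSet r v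
      · obtain ⟨u, huC, hu⟩ := hmeet
        obtain ⟨a, h1, h2, h3, h4⟩ := limInfStep_hit hG r st v hC huC hu
        exact Or.inr ⟨a, h1, h2, h3, hLv.trans h4.ge⟩
      · refine Or.inl ⟨(List.mem_cons.1 hLl).resolve_left ?_, fun s hs => ?_⟩
        -- At `v = L` the set `C` must be hit: all its rewards are at least `L`, so staying in `C`
        -- wins almost surely.
        · rintro rfl
          obtain ⟨s, hs⟩ := hne
          let _ : MeasurableSpace S := ⊤
          exact hmeet ⟨⟨s, hlive hs⟩, hs, hCsub.subset_winOne (G := st.cur)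
            (fun t ht => hL t ht) hs⟩
        · refine ⟨⟨s, hlive hs⟩, fun hs' => hmeet ?_, rfl⟩
          exact IsSub.inter_nonempty_of_attr (G := st.cur) hCsub ⟨_, hs, hs'⟩
    · obtain ⟨h5, h6, h7⟩ := limInfStep_persist r st v h2 h3
      exact Or.inr ⟨a, h1, h5, h6, h7 ▸ h4⟩

/-- Every nonempty set to which `G` can be restricted contains a state of `Sstar` at which `fstar`
is at least the least reward in the set. -/
lemma exists_mem_Sstar (hG : G.IsBipartite) (r : S → ℝ) {C : Set S} (hC : G.IsSub C) {t : S}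
    (ht : t ∈ C) (hmin : ∀ u ∈ C, r t ≤ r u) :
    ∃ a ∈ C, a ∈ (G.mdpLimInf r).Sstar ∧ r t ≤ (G.mdpLimInf r).fstar a := by
  refine exists_mem_Sstar_foldl hG r hC ⟨t, ht⟩ hmin _ (Finset.pairwise_sort _ _) _
    (Or.inl ⟨?_, Set.subset_univ C⟩)
  simp

/-- The value-one set, in the current MDP, for the reward `v` consists of states of liminf value at
least `v`. -/
lemma le_value_of_mem_winSet {r : S → ℝ} (hr : ∀ s, 0 < r s) (st : G.LimInfState) {v : ℝ}
    (hv : 0 < v) {u : ↥st.live} (hu : u ∈ st.winSet r v) : v ≤ G.value (liminfObj r) u := by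
  let _ : MeasurableSpace S := ⊤
  have hW := (excessive_value_liminfObj (G := G) r).restrict st.isSub
  set D : Set ↥st.live := {s | v ≤ r s}
  -- The liminf-value of `G` remains excessive on the live part, so no strategy has to be
  -- transferred to `G`. On the coBüchi event the recurrent set restricts `G` and has rewards at
  -- least `v`, so the value there is at least `v`; off the event nonnegativity suffices. Taking the
  -- supremum over `σ` needs no optimal strategy.
  have key : ∀ σ : st.cur.Strategy, σ.prob u (coBuchi D) ≤ G.value (liminfObj r) u / v := by
    intro σ
    rw [le_div_iff₀ hv, σ.prob_eq_measureReal, ← integral_indicator_one (measurableSet_coBuchi D),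
      ← integral_mul_const]
    refine hW.integral_le σ u (((integrable_const (μ := σ.playMeasure u) (1 : ℝ)).indicator
      (measurableSet_coBuchi D)).mul_const v) ?_
    filter_upwards [σ.ae_isSub_infStates u] with ω hω
    by_cases hD : ω ∈ coBuchi D
    · obtain ⟨t, ht⟩ := infStates_nonempty ω
      refine Frequently.mono ht fun n hn => ?_
      rw [Set.indicator_of_mem hD, Pi.one_apply, one_mul, hn]
      refine (st.isSub.image hω).le_value_liminfObj ?_ ⟨t, ht, rfl⟩
      rintro _ ⟨w, hw, rfl⟩
      exact hD hw
    · rw [Set.indicator_of_notMem hD, zero_mul]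
      exact Frequently.of_forall fun n => value_liminfObj_nonneg hr _
  have h1 : st.cur.qualValue (coBuchi D) u = 1 := hu
  have h2 : st.cur.qualValue (coBuchi D) u ≤ G.value (liminfObj r) u / v := ciSup_le key
  rwa [h1, le_div_iff₀ hv, one_mul] at h2

/-- Both bounds are loop invariants, by `le_value_of_mem_winSet` and the positivity of rewards. The
second makes the moves into copies non-increasing for the `W` of `value_maxObj_le`; the first makes
that `W` nonnegative on the copies. -/
lemma fstar_pos_and_le_value {r : S → ℝ} (hr : ∀ s, 0 < r s) {a : S}
    (ha : a ∈ (G.mdpLimInf r).Sstar) :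
    0 < (G.mdpLimInf r).fstar a ∧ (G.mdpLimInf r).fstar a ≤ G.value (liminfObj r) a := by
  have key : ∀ (l : List ℝ), (∀ v ∈ l, 0 < v) → ∀ st : G.LimInfState,
      (∀ a ∈ st.Sstar, 0 < st.fstar a ∧ st.fstar a ≤ G.value (liminfObj r) a) →
      ∀ a ∈ (l.foldl (G.limInfStep r) st).Sstar, 0 < (l.foldl (G.limInfStep r) st).fstar a ∧
        (l.foldl (G.limInfStep r) st).fstar a ≤ G.value (liminfObj r) a := by
    intro l
    induction l with
    | nil => exact fun _ _ h => h
    | cons v l ih =>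
      intro hl st hst
      refine ih (fun w hw => hl w (List.mem_cons_of_mem _ hw)) _ fun a ha => ?_
      have hv := hl v List.mem_cons_self
      by_cases hU : a ∈ Subtype.val '' st.winSet r v ∩ G.P1
      · obtain ⟨⟨u, hu, rfl⟩, -⟩ := id hU
        rw [show (G.limInfStep r st v).fstar u = v from if_pos hU]
        exact ⟨hv, le_value_of_mem_winSet hr st hv hu⟩
      · rw [show (G.limInfStep r st v).fstar a = st.fstar a from if_neg hU]
        exact hst a (Or.resolve_right ha hU)
  refine key _ (fun v hv => ?_) _ (fun a ha => absurd ha (Set.notMem_empty a)) a ha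
  simp only [rewardList, Finset.mem_sort, Set.Finite.mem_toFinset] at hv
  obtain ⟨s, rfl⟩ := hv
  exact hr s

end Algorithm

/-! ### Correctness of the liminf conversion -/

lemma value_liminfObj_le [Finite S] (hG : G.IsBipartite) (r : S → ℝ) (s : S) :
    G.value (liminfObj r) s ≤ (G.limInfConversion r).value (maxObj (G.limInfReward r)) (.inl s) := by
  let _ : MeasurableSpace S := ⊤
  let _ : MeasurableSpace (S ⊕ ↥(G.mdpLimInf r).Sstar) := ⊤
  obtain ⟨M, hM⟩ := exists_abs_le r
  obtain ⟨hW, hcopy⟩ := (excessive_addCopies_iff (G.mdpLimInf_Sstar_subset r)).1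
    (excessive_value_maxObj (G := G.limInfConversion r) (G.limInfReward r))
  refine ciSup_le fun σ => ?_
  rw [σ.expect_eq_integral]
  refine hW.integral_le σ s
    (integrable_of_abs_le (measurable_liminfObj r) (abs_liminfObj_le hM)) ?_
  filter_upwards [σ.ae_isSub_infStates s] with ω hω
  obtain ⟨t, ht, h, hmin⟩ := exists_liminfObj_eq r ω
  obtain ⟨a, ha, haS, hta⟩ := exists_mem_Sstar hG r hω ht hmin
  refine Frequently.mono ha fun n hn => ?_
  rw [h, hn]
  exact hta.trans ((le_value_maxObj (G := G.limInfConversion r) (G.limInfReward r)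
    (.inr ⟨a, haS⟩)).trans (hcopy ⟨a, haS⟩))

lemma value_maxObj_le [Finite S] {r : S → ℝ} (hr : ∀ s, 0 < r s) (s : S) :
    (G.limInfConversion r).value (maxObj (G.limInfReward r)) (.inl s) ≤ G.value (liminfObj r) s := by
  let _ : MeasurableSpace S := ⊤
  let _ : MeasurableSpace (S ⊕ ↥(G.mdpLimInf r).Sstar) := ⊤
  obtain ⟨M, hM⟩ := exists_abs_le (G.limInfReward r)
  set W : S ⊕ ↥(G.mdpLimInf r).Sstar → ℝ :=
    Sum.elim (G.value (liminfObj r)) fun a => (G.mdpLimInf r).fstar a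
  have hW : (G.limInfConversion r).Excessive W :=
    (excessive_addCopies_iff (G.mdpLimInf_Sstar_subset r)).2
      ⟨excessive_value_liminfObj r, fun a => (fstar_pos_and_le_value hr a.2).2⟩
  have h0 : ∀ x, 0 ≤ W x := by
    rintro (x | a)
    · exact value_liminfObj_nonneg hr x
    · exact (fstar_pos_and_le_value hr a.2).1.le
  refine ciSup_le fun σ => ?_
  rw [σ.expect_eq_integral]
  refine hW.integral_le σ (.inl s)
    (integrable_of_abs_le (measurable_maxObj _) (abs_maxObj_le hM)) ?_
  filter_upwards [σ.ae_edge (.inl s)] with ω hω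
  obtain ⟨k, hk⟩ := exists_maxObj_eq (G.limInfReward r) ω
  -- After a time `k` attaining the maximum, either the payoff is `0`, or the play sits in an
  -- absorbing copy where `W` equals the payoff.
  refine Eventually.frequently ((eventually_ge_atTop k).mono fun n hn => ?_)
  rw [hk]
  rcases hx : ω k with x | a
  · exact h0 _
  · have hstay : ω n = .inr a := by
      induction n, hn using Nat.le_induction with
      | base => exact hx
      | succ n _ ih =>
        have he : G.CopyEdge (G.mdpLimInf r).Sstar (ω n) (ω (n + 1)) := hω n
        rw [ih] at he
        generalize ω (n + 1) = y at he
        cases he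
        rfl
    rw [hstay]
    exact le_rfl

end MDP

theorem mainTheorem5 {S : Type*} [Finite S] (G : MDP S) (hG : G.IsBipartite)
    (r : S → ℝ) (hr : ∀ s, 0 < r s) (s : S) :
    G.value (MDP.liminfObj r) s =
      (G.limInfConversion r).value (MDP.maxObj (G.limInfReward r)) (Sum.inl s) :=
  le_antisymm (MDP.value_liminfObj_le hG r s) (MDP.value_maxObj_le hr s)
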